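/- Let $\mathcal M$ be a II$_1$ factor acting on a complex Hilbert space (a finite factor without minimal projections), with faithful normal tracial state $\tau$. For $T\in\mathcal M$ let $|T|=(T^*T)^{1/2}$, let $m_{|T|}$ be the spectral distribution of $|T|$, i.e. the unique Borel probability measure on $\mathbb R$ with $\int s^n\,dm_{|T|}(s)=\tau(|T|^n)$ for all $n\ge 0$, and define the singular value function of $T$ by $$\mu_s(T)=\inf\{t\in\mathbb R : m_{|T|}((t,\infty))\le s\},\qquad s\in[0,1).$$ For $S,T\in\mathcal M$ write $S\prec_w T$ if $\int_0^t\mu_s(S)\,ds\le\int_0^t\mu_s(T)\,ds$ for all $t\in[0,1]$. Let $\mathcal N\subseteq\mathcal M$ be a diffuse von Neumann subalgebra (one without minimal projections, with the same unit as $\mathcal M$) and let $E_{\mathcal N}:\mathcal M\to\mathcal N$ be the $\tau$-preserving normal conditional expectation onto $\mathcal N$. Then $E_{\mathcal N}(T)\prec_w T$ for every $T\in\mathcal M$. -/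

import Mathlib

open scoped ComplexOrder CompactlySupported
open MeasureTheory

namespace VonNeumannAlgebra

variable {H : Type*} [NormedAddCommGroup H] [InnerProductSpace ℂ H] [CompleteSpace H]

/-! ### Factors of type II₁ and diffuse algebras

Elements of a von Neumann algebra `M` are handled as terms of the type `M.toStarSubalgebra`, with
its `*`-algebra structure and its order `x ≤ y` (`y - x` is a positive operator). -/

/-- The centre of `M` consists of the scalar operators, and `M` is not the zero algebra. -/
structure IsFactor (M : VonNeumannAlgebra H) : Prop where
  nontrivial : (1 : M.toStarSubalgebra) ≠ 0
  center_eq_scalars : ∀ z : M.toStarSubalgebra, (∀ x, z * x = x * z) → ∃ c : ℂ, z = c • 1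

/-- `M` is finite: every isometry in `M` is unitary. -/
def IsFinite (M : VonNeumannAlgebra H) : Prop :=
  ∀ v : M.toStarSubalgebra, star v * v = 1 → v * star v = 1

/-- `M` is diffuse: it has no minimal projection, i.e. every nonzero projection of `M` has a
nonzero proper subprojection in `M`. -/
def IsDiffuse (M : VonNeumannAlgebra H) : Prop :=
  ∀ p : M.toStarSubalgebra, IsStarProjection p → p ≠ 0 →
    ∃ q : M.toStarSubalgebra, IsStarProjection q ∧ q ≤ p ∧ q ≠ 0 ∧ q ≠ p

/-- `M` is a factor of type II₁: a finite factor without minimal projections. -/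
structure IsIIOneFactor (M : VonNeumannAlgebra H) : Prop where
  isFactor : M.IsFactor
  isFinite : M.IsFinite
  isDiffuse : M.IsDiffuse

/-! ### Traces and conditional expectations -/

/-- A faithful normal unital trace on `M`, i.e. a faithful normal tracial state. Normality is
compatibility with suprema of bounded upward directed families. -/
structure FaithfulNormalTrace (M : VonNeumannAlgebra H) where
  /-- The underlying linear functional. -/
  toLin : M.toStarSubalgebra →ₗ[ℂ] ℂ
  map_one : toLin 1 = 1
  nonneg : ∀ x, 0 ≤ x → 0 ≤ toLin x
  faithful : ∀ x, 0 ≤ x → toLin x = 0 → x = 0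
  trace : ∀ x y, toLin (x * y) = toLin (y * x)
  normal : ScottContinuous toLin

/-- The inclusion of a von Neumann subalgebra `N` (with the same unit) into `M`. -/
noncomputable def incl {N M : VonNeumannAlgebra H} (h : N ≤ M) :
    N.toStarSubalgebra →⋆ₐ[ℂ] M.toStarSubalgebra :=
  StarSubalgebra.inclusion h

/-- `E : M → N` is the trace-preserving normal conditional expectation onto the von Neumann
subalgebra `N` of `M`: a normal positive `N`-bimodule projection of `M` onto `N` that preserves
the trace `τ`. -/
structure IsTraceExpectation {N M : VonNeumannAlgebra H} (h : N ≤ M) (τ : M.FaithfulNormalTrace)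
    (E : M.toStarSubalgebra →ₗ[ℂ] N.toStarSubalgebra) : Prop where
  map_incl : ∀ a, E (incl h a) = a
  nonneg : ∀ x, 0 ≤ x → 0 ≤ E x
  bimodule : ∀ a x b, E (incl h a * x * incl h b) = a * E x * b
  normal : ScottContinuous E
  trace_preserving : ∀ x, τ.toLin (incl h (E x)) = τ.toLin x

/-! ### The spectral distribution of a self-adjoint element -/

/-- A von Neumann algebra is norm closed. -/
theorem isClosed_toStarSubalgebra (M : VonNeumannAlgebra H) :
    IsClosed (M.toStarSubalgebra : Set (H →L[ℂ] H)) := by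
  rw [coe_toStarSubalgebra, ← centralizer_centralizer M]
  exact Set.isClosed_centralizer _

/-- `M` is closed under the continuous functional calculus. -/
theorem cfcHom_mem (M : VonNeumannAlgebra H) {T : H →L[ℂ] H} (hM : T ∈ M.toStarSubalgebra)
    (hT : IsSelfAdjoint T) (f : C(spectrum ℝ T, ℝ)) : cfcHom hT f ∈ M.toStarSubalgebra := by
  have : IsClosed (M.toStarSubalgebra : Set (H →L[ℂ] H)) := M.isClosed_toStarSubalgebra
  have : SMulMemClass (StarSubalgebra ℂ (H →L[ℂ] H)) ℝ (H →L[ℂ] H) :=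
    SMulMemClass.ofIsScalarTower _ ℝ ℂ (H →L[ℂ] H)
  have h := StarSubalgebra.topologicalClosure_minimal (R := ℝ)
    (s := StarAlgebra.adjoin ℝ {T}) (t := .ofClass M.toStarSubalgebra)
    (by simpa using hM) (by simpa using M.isClosed_toStarSubalgebra)
  exact h (cfcHom_mem_elemental hT f)

/-- For self-adjoint `T ∈ M`, the positive functional `f ↦ τ (f(T))` on the continuous real
functions on the (compact) spectrum of `T`. -/
noncomputable def spectralFunctional {M : VonNeumannAlgebra H} (τ : M.FaithfulNormalTrace)
    (T : M.toStarSubalgebra) (hT : IsSelfAdjoint (T : H →L[ℂ] H)) :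
    C_c(spectrum ℝ (T : H →L[ℂ] H), ℝ) →ₚ[ℝ] ℝ where
  toFun f := (τ.toLin ⟨cfcHom hT f.toContinuousMap, M.cfcHom_mem T.2 hT _⟩).re
  map_add' f g := by
    rw [← Complex.add_re, ← map_add]
    congr 2
    ext1
    exact map_add (cfcHom hT) f.toContinuousMap g.toContinuousMap
  map_smul' c f := by
    have : (⟨cfcHom hT (c • f).toContinuousMap, M.cfcHom_mem T.2 hT _⟩ : M.toStarSubalgebra)
        = (c : ℂ) • ⟨cfcHom hT f.toContinuousMap, M.cfcHom_mem T.2 hT _⟩ := by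
      ext1
      refine (map_smul (cfcHom hT) c f.toContinuousMap).trans ?_
      simp
    rw [this, map_smul]
    simp
  monotone' f g hfg := by
    have h0 : (0 : M.toStarSubalgebra) ≤ ⟨cfcHom hT g.toContinuousMap, M.cfcHom_mem T.2 hT _⟩ -
        ⟨cfcHom hT f.toContinuousMap, M.cfcHom_mem T.2 hT _⟩ :=
      sub_nonneg.2 (cfcHom_mono hT (f := f.toContinuousMap) (g := g.toContinuousMap) hfg)
    have h1 := τ.nonneg _ h0
    rw [map_sub] at h1
    simpa using (Complex.le_def.1 h1).1

/-- The spectral distribution `m_T` of a self-adjoint `T ∈ M`: the Borel probability measure on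
`ℝ`, carried by the spectrum of `T`, with `∫ f dm_T = τ (f(T))` for continuous `f`
(Riesz–Markov–Kakutani). Its moments are `∫ sⁿ dm_T(s) = τ (Tⁿ)`, as proved in
`integral_pow_spectralDistribution`; these moments determine the measure. -/
noncomputable def spectralDistribution {M : VonNeumannAlgebra H} (τ : M.FaithfulNormalTrace)
    (T : M.toStarSubalgebra) (hT : IsSelfAdjoint (T : H →L[ℂ] H)) : Measure ℝ :=
  (RealRMK.rieszMeasure (spectralFunctional τ T hT)).map Subtype.val

theorem integral_spectralDistribution {M : VonNeumannAlgebra H} (τ : M.FaithfulNormalTrace)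
    (T : M.toStarSubalgebra) (hT : IsSelfAdjoint (T : H →L[ℂ] H)) (f : C(ℝ, ℝ)) :
    ∫ s, f s ∂(spectralDistribution τ T hT) =
      (τ.toLin ⟨cfcHom hT (f.restrict _), M.cfcHom_mem T.2 hT _⟩).re := by
  rw [spectralDistribution, integral_map (by fun_prop) (by fun_prop)]
  exact RealRMK.integral_rieszMeasure (spectralFunctional τ T hT)
    ⟨f.restrict _, HasCompactSupport.of_compactSpace _⟩

/-- The trace of a self-adjoint element is real. -/
theorem FaithfulNormalTrace.im_eq_zero {M : VonNeumannAlgebra H} (τ : M.FaithfulNormalTrace)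
    (x : M.toStarSubalgebra) (hx : IsSelfAdjoint (x : H →L[ℂ] H)) : (τ.toLin x).im = 0 := by
  have h0 : (0 : M.toStarSubalgebra) ≤ (‖(x : H →L[ℂ] H)‖ : ℂ) • 1 - x := by
    refine sub_nonneg.2 (show (x : H →L[ℂ] H) ≤ _ from ?_)
    refine hx.le_algebraMap_norm_self.trans_eq ?_
    simp [Algebra.algebraMap_eq_smul_one]
  have h1 := (Complex.le_def.1 (τ.nonneg _ h0)).2
  simpa [τ.map_one] using h1

theorem integral_pow_spectralDistribution {M : VonNeumannAlgebra H} (τ : M.FaithfulNormalTrace)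
    (T : M.toStarSubalgebra) (hT : IsSelfAdjoint (T : H →L[ℂ] H)) (n : ℕ) :
    ((∫ s, s ^ n ∂(spectralDistribution τ T hT) : ℝ) : ℂ) = τ.toLin (T ^ n) := by
  have h := integral_spectralDistribution τ T hT ⟨fun s => s ^ n, by fun_prop⟩
  have e : (⟨cfcHom hT ((⟨fun s : ℝ => s ^ n, by fun_prop⟩ : C(ℝ, ℝ)).restrict _),
      M.cfcHom_mem T.2 hT _⟩ : M.toStarSubalgebra) = T ^ n := by
    ext1
    refine Eq.trans ?_ ((map_pow (cfcHom hT) ((ContinuousMap.id ℝ).restrict _) n).trans ?_)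
    · rfl
    · rw [cfcHom_id hT]; rfl
  rw [e] at h
  apply Complex.ext
  · simpa using h
  · have : IsSelfAdjoint ((T ^ n : M.toStarSubalgebra) : H →L[ℂ] H) := hT.pow n
    rw [τ.im_eq_zero _ this, Complex.ofReal_im]

instance isProbabilityMeasure_spectralDistribution {M : VonNeumannAlgebra H}
    (τ : M.FaithfulNormalTrace) (T : M.toStarSubalgebra) (hT : IsSelfAdjoint (T : H →L[ℂ] H)) :
    IsProbabilityMeasure (spectralDistribution τ T hT) := by
  have hfin : IsFiniteMeasure (spectralDistribution τ T hT) := by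
    unfold spectralDistribution; infer_instance
  have h := integral_pow_spectralDistribution τ T hT 0
  simp only [pow_zero, τ.map_one, integral_const, smul_eq_mul, mul_one] at h
  have h' : (spectralDistribution τ T hT).real Set.univ = 1 := by exact_mod_cast h
  exact ⟨by rwa [measureReal_def, ENNReal.toReal_eq_one_iff] at h'⟩

theorem spectralDistribution_compl_spectrum {M : VonNeumannAlgebra H}
    (τ : M.FaithfulNormalTrace) (T : M.toStarSubalgebra) (hT : IsSelfAdjoint (T : H →L[ℂ] H)) :
    spectralDistribution τ T hT (spectrum ℝ (T : H →L[ℂ] H))ᶜ = 0 := by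
  rw [spectralDistribution, Measure.map_apply (by fun_prop)
    (spectrum.isClosed _).measurableSet.compl]
  simp

/-! ### Eigenvalue functions, singular value functions and submajorization -/

/-- The eigenvalue function `λ_s(T) = inf {t | m_T((t, ∞)) ≤ s}`, `s ∈ [0, 1)`, of a self-adjoint
`T ∈ M`. -/
noncomputable def eigenvalueFunction {M : VonNeumannAlgebra H} (τ : M.FaithfulNormalTrace)
    (T : M.toStarSubalgebra) (hT : IsSelfAdjoint (T : H →L[ℂ] H)) (s : ℝ) : ℝ :=
  sInf {t : ℝ | (spectralDistribution τ T hT).real (Set.Ioi t) ≤ s}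

theorem abs_mem (M : VonNeumannAlgebra H) {T : H →L[ℂ] H} (hM : T ∈ M.toStarSubalgebra) :
    CFC.abs T ∈ M.toStarSubalgebra := by
  have : IsClosed (M.toStarSubalgebra : Set (H →L[ℂ] H)) := M.isClosed_toStarSubalgebra
  rw [CFC.abs, CFC.sqrt_eq_real_sqrt _ (star_mul_self_nonneg T)]
  exact cfcₙ_mem _ (mul_mem (star_mem hM) hM)

/-- The absolute value `|T| = (T* T)^{1/2}` of an element of `M`, which lies in `M`. -/
noncomputable def absolute {M : VonNeumannAlgebra H} (T : M.toStarSubalgebra) :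
    M.toStarSubalgebra :=
  ⟨CFC.abs (T : H →L[ℂ] H), M.abs_mem T.2⟩

theorem isSelfAdjoint_absolute {M : VonNeumannAlgebra H} (T : M.toStarSubalgebra) :
    IsSelfAdjoint (absolute T : H →L[ℂ] H) :=
  (CFC.abs_nonneg (T : H →L[ℂ] H)).isSelfAdjoint

/-- The singular value function `μ_s(T) = λ_s(|T|)`, `s ∈ [0, 1)`, of `T ∈ M`. -/
noncomputable def singularValueFunction {M : VonNeumannAlgebra H} (τ : M.FaithfulNormalTrace)
    (T : M.toStarSubalgebra) (s : ℝ) : ℝ :=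
  eigenvalueFunction τ (absolute T) (isSelfAdjoint_absolute T) s

/-- The integrals in the definition of submajorization are integrals of integrable functions. -/
theorem intervalIntegrable_singularValueFunction {M : VonNeumannAlgebra H}
    (τ : M.FaithfulNormalTrace) (T : M.toStarSubalgebra) {t : ℝ} (ht : t ∈ Set.Icc (0 : ℝ) 1) :
    IntervalIntegrable (singularValueFunction τ T) volume 0 t := by
  set A := absolute T
  have hA := isSelfAdjoint_absolute T
  set m := spectralDistribution τ A hA with hm
  obtain ⟨r, hr⟩ := (spectrum.isBounded (𝕜 := ℝ) (A : H →L[ℂ] H)).subset_closedBall 0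
  have hsub : ∀ x ∈ spectrum ℝ (A : H →L[ℂ] H), |x| ≤ r := fun x hx => by
    simpa using hr hx
  have hhigh : m.real (Set.Ioi r) = 0 := by
    rw [measureReal_def, measure_mono_null _ (spectralDistribution_compl_spectrum τ A hA)]
    · simp
    · intro x hx hx'
      exact absurd (hsub x hx') (not_le.2 (lt_of_lt_of_le hx (le_abs_self x)))
  have hlow : ∀ t < -r, m.real (Set.Ioi t) = 1 := by
    intro t ht
    have h1 : m (Set.Ioi t)ᶜ = 0 := by
      refine measure_mono_null ?_ (spectralDistribution_compl_spectrum τ A hA)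
      intro x hx hx'
      have := neg_le_of_abs_le (hsub x hx')
      simp only [Set.mem_compl_iff, Set.mem_Ioi, not_lt] at hx
      linarith
    have h2 := (prob_compl_eq_zero_iff (μ := m) measurableSet_Ioi).1 h1
    simp [measureReal_def, h2]
  have hmem : ∀ s, 0 ≤ s → r ∈ {t : ℝ | m.real (Set.Ioi t) ≤ s} := fun s hs => by
    simpa [hhigh] using hs
  have hbdd : ∀ s < 1, -r ∈ lowerBounds {t : ℝ | m.real (Set.Ioi t) ≤ s} := by
    intro s hs t ht
    by_contra! hlt
    have := hlow t hlt
    simp only [Set.mem_ofPred_eq] at ht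
    linarith
  have hanti : AntitoneOn (singularValueFunction τ T) (Set.Ico 0 1) := by
    intro s hs s' hs' hss
    exact csInf_le_csInf ⟨_, hbdd s' hs'.2⟩ ⟨r, hmem s hs.1⟩ (fun t ht => le_trans ht hss)
  have hbound : ∀ s ∈ Set.Ico (0 : ℝ) 1, ‖singularValueFunction τ T s‖ ≤ r := by
    intro s hs
    rw [Real.norm_eq_abs, abs_le]
    exact ⟨le_csInf ⟨r, hmem s hs.1⟩ (hbdd s hs.2), csInf_le ⟨_, hbdd s hs.2⟩ (hmem s hs.1)⟩
  rw [intervalIntegrable_iff_integrableOn_Ico_of_le ht.1]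
  have hI : IntegrableOn (singularValueFunction τ T) (Set.Ico 0 1) volume :=
    ⟨(aemeasurable_restrict_of_antitoneOn measurableSet_Ico hanti).aestronglyMeasurable,
      HasFiniteIntegral.of_bounded (C := r)
        ((ae_restrict_iff' measurableSet_Ico).2 (Filter.Eventually.of_forall hbound))⟩
  exact hI.mono_set (Set.Ico_subset_Ico_right ht.2)

/-- `S ≺_w T`: the element `S` of `M` is (absolutely) submajorized by the element `T` of `M`. -/
def IsSubmajorized {M : VonNeumannAlgebra H} (τ : M.FaithfulNormalTrace)
    (S T : M.toStarSubalgebra) : Prop :=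
  ∀ t ∈ Set.Icc (0 : ℝ) 1,
    ∫ s in (0 : ℝ)..t, singularValueFunction τ S s ≤ ∫ s in (0 : ℝ)..t, singularValueFunction τ T s

end VonNeumannAlgebra

/-! The integral of `μ_s(T)` over `(0, t)` is the minimum over `c ≥ 0` of `t c + τ((|T| - c)₊)`:
every `c` gives an upper bound, and a threshold separating the values of `μ` before `t` from those
after gives equality. Submajorization therefore reduces to `τ((|E(T)| - c)₊) ≤ τ((|T| - c)₊)` for
each `c ≥ 0` (`IsTraceExpectation.re_truncation_le`).

That inequality is a duality argument. Splitting `T` at height `c` and applying Hölder to both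
pieces gives `Re τ(XT) - c τ(|X*|) ≤ τ((|T| - c)₊)` whenever `‖X‖ ≤ 1` (`re_mul_le_truncation`). For
`X` in `N` the trace does not distinguish `T` from `S = E(T)`. Taking `X` close to the adjoint of
the phase of `S`, cut to the part of `|S|` above `c`, brings the left side close to `τ((|S| - c)₊)`.
Regularized continuous functions of `|S|` replace polar decomposition and spectral projections. -/

namespace VonNeumannAlgebra

/-! ### Continuous functional calculus inside the algebra -/

section ContinuousCalculus

variable {H : Type*} [NormedAddCommGroup H] [InnerProductSpace ℂ H] [CompleteSpace H]

/-- The continuous functional calculus of `P`, as an element of the von Neumann algebra. -/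
noncomputable def fc {M : VonNeumannAlgebra H} (P : M.toStarSubalgebra) (φ : ℝ → ℝ) :
    M.toStarSubalgebra :=
  ⟨cfc φ (P : H →L[ℂ] H), by
    have : IsClosed (M.toStarSubalgebra : Set (H →L[ℂ] H)) := M.isClosed_toStarSubalgebra
    exact cfc_mem φ P.2⟩

variable {M : VonNeumannAlgebra H}

theorem fc_mul (P : M.toStarSubalgebra) {φ ψ : ℝ → ℝ} (hφ : Continuous φ) (hψ : Continuous ψ) :
    fc P φ * fc P ψ = fc P (fun x => φ x * ψ x) :=
  Subtype.ext (cfc_mul φ ψ (P : H →L[ℂ] H) hφ.continuousOn hψ.continuousOn).symm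

theorem fc_add (P : M.toStarSubalgebra) {φ ψ : ℝ → ℝ} (hφ : Continuous φ) (hψ : Continuous ψ) :
    fc P φ + fc P ψ = fc P (fun x => φ x + ψ x) :=
  Subtype.ext (cfc_add (P : H →L[ℂ] H) φ ψ hφ.continuousOn hψ.continuousOn).symm

theorem fc_const (P : M.toStarSubalgebra) (hP : IsSelfAdjoint (P : H →L[ℂ] H)) (c : ℝ) :
    fc P (fun _ => c) = (c : ℂ) • 1 :=
  Subtype.ext ((cfc_const c (P : H →L[ℂ] H) hP).trans (by
    simp [Algebra.algebraMap_eq_smul_one]))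

theorem fc_const_mul (P : M.toStarSubalgebra) {φ : ℝ → ℝ} (c : ℝ) (hφ : Continuous φ) :
    fc P (fun x => c * φ x) = (c : ℂ) • fc P φ :=
  Subtype.ext ((cfc_const_mul c φ (P : H →L[ℂ] H) hφ.continuousOn).trans (by simp [fc]))

theorem fc_id (P : M.toStarSubalgebra) (hP : IsSelfAdjoint (P : H →L[ℂ] H)) :
    fc P (fun x => x) = P :=
  Subtype.ext (cfc_id' ℝ (P : H →L[ℂ] H) hP)

theorem star_fc (P : M.toStarSubalgebra) (φ : ℝ → ℝ) : star (fc P φ) = fc P φ :=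
  Subtype.ext (IsSelfAdjoint.cfc (f := φ) (a := (P : H →L[ℂ] H)))

theorem spectrum_nonneg {P : M.toStarSubalgebra} (hP : 0 ≤ P) :
    ∀ x ∈ spectrum ℝ (P : H →L[ℂ] H), 0 ≤ x := fun _ hx =>
  spectrum_nonneg_of_nonneg (show (0 : H →L[ℂ] H) ≤ P from hP) hx

theorem isSelfAdjoint_of_nonneg {P : M.toStarSubalgebra} (hP : 0 ≤ P) :
    IsSelfAdjoint (P : H →L[ℂ] H) :=
  IsSelfAdjoint.of_nonneg (show (0 : H →L[ℂ] H) ≤ P from hP)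

theorem fc_congr {P : M.toStarSubalgebra} (hP : 0 ≤ P) {φ ψ : ℝ → ℝ}
    (h : ∀ x, 0 ≤ x → φ x = ψ x) : fc P φ = fc P ψ :=
  Subtype.ext (cfc_congr fun x hx => h x (spectrum_nonneg hP x hx))

theorem fc_mono {P : M.toStarSubalgebra} (hP : 0 ≤ P) {φ ψ : ℝ → ℝ} (hφ : Continuous φ)
    (hψ : Continuous ψ) (h : ∀ x, 0 ≤ x → φ x ≤ ψ x) : fc P φ ≤ fc P ψ :=
  show cfc φ (P : H →L[ℂ] H) ≤ cfc ψ (P : H →L[ℂ] H) from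
    cfc_mono (fun x hx => h x (spectrum_nonneg hP x hx)) hφ.continuousOn hψ.continuousOn

theorem fc_nonneg {P : M.toStarSubalgebra} (hP : 0 ≤ P) {φ : ℝ → ℝ}
    (h : ∀ x, 0 ≤ x → 0 ≤ φ x) : 0 ≤ fc P φ :=
  show 0 ≤ cfc φ (P : H →L[ℂ] H) from
    cfc_nonneg (fun x hx => h x (spectrum_nonneg hP x hx))

theorem norm_fc_le_one {P : M.toStarSubalgebra} (hP : 0 ≤ P) {φ : ℝ → ℝ}
    (h : ∀ x, 0 ≤ x → |φ x| ≤ 1) : ‖fc P φ‖ ≤ 1 :=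
  norm_cfc_le zero_le_one fun x hx => h x (spectrum_nonneg hP x hx)

theorem absolute_nonneg (T : M.toStarSubalgebra) : 0 ≤ absolute T :=
  CFC.abs_nonneg (T : H →L[ℂ] H)

theorem star_mul_self_eq_fc (T : M.toStarSubalgebra) :
    star T * T = fc (absolute T) (fun x => x * x) := by
  rw [← fc_mul _ continuous_id' continuous_id', fc_id _ (isSelfAdjoint_absolute T)]
  exact Subtype.ext (CFC.abs_mul_abs (T : H →L[ℂ] H)).symm

theorem norm_le_one_of_norm_star_mul_self_le_one {x : M.toStarSubalgebra}
    (h : ‖star x * x‖ ≤ 1) : ‖x‖ ≤ 1 := by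
  have h1 : ‖star x * x‖ = ‖x‖ * ‖x‖ := CStarRing.norm_star_mul_self (x := (x : H →L[ℂ] H))
  nlinarith [norm_nonneg x]

theorem norm_star_eq (x : M.toStarSubalgebra) : ‖star x‖ = ‖x‖ :=
  norm_star (x : H →L[ℂ] H)

theorem star_mul_self_le_one {x : M.toStarSubalgebra} (h : ‖x‖ ≤ 1) : star x * x ≤ 1 := by
  have h1 : star (x : H →L[ℂ] H) * x ≤ algebraMap ℝ _ (‖(x : H →L[ℂ] H)‖ ^ 2) :=
    CStarAlgebra.star_mul_le_algebraMap_norm_sq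
  have h2 : algebraMap ℝ (H →L[ℂ] H) (‖(x : H →L[ℂ] H)‖ ^ 2) ≤ algebraMap ℝ _ 1 :=
    algebraMap_mono _ (pow_le_one₀ (norm_nonneg _) h)
  have h3 := h1.trans h2
  rw [map_one] at h3
  exact h3

end ContinuousCalculus

/-! ### Trace inequalities: Hölder and truncation -/

namespace FaithfulNormalTrace

variable {H : Type*} [NormedAddCommGroup H] [InnerProductSpace ℂ H] [CompleteSpace H]
  {M : VonNeumannAlgebra H} (τ : M.FaithfulNormalTrace)

/-- The real part of the trace. -/
noncomputable def re (x : M.toStarSubalgebra) : ℝ := (τ.toLin x).re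

theorem re_add (x y : M.toStarSubalgebra) : τ.re (x + y) = τ.re x + τ.re y := by
  simp [re]

theorem re_sub (x y : M.toStarSubalgebra) : τ.re (x - y) = τ.re x - τ.re y := by
  simp [re]

theorem re_smul (c : ℝ) (x : M.toStarSubalgebra) : τ.re ((c : ℂ) • x) = c * τ.re x := by
  simp [re]

theorem re_one : τ.re 1 = 1 := by simp [re, τ.map_one]

theorem re_mul_comm (x y : M.toStarSubalgebra) : τ.re (x * y) = τ.re (y * x) := by
  rw [re, τ.trace, re]

theorem re_nonneg {x : M.toStarSubalgebra} (hx : 0 ≤ x) : 0 ≤ τ.re x :=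
  (Complex.le_def.1 (τ.nonneg x hx)).1

theorem re_mono {x y : M.toStarSubalgebra} (h : x ≤ y) : τ.re x ≤ τ.re y := by
  have h1 : (0 : M.toStarSubalgebra) ≤ y - x := by
    show (0 : H →L[ℂ] H) ≤ y - x
    exact sub_nonneg.2 (show (x : H →L[ℂ] H) ≤ y from h)
  have := τ.re_nonneg h1
  rw [re_sub] at this
  linarith

theorem re_star (x : M.toStarSubalgebra) : τ.re (star x) = τ.re x := by
  -- The trace of the self-adjoint element `i(x - x*)` is real.
  have h : IsSelfAdjoint ((Complex.I • (x - star x) : M.toStarSubalgebra) : H →L[ℂ] H) := by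
    have : star (Complex.I • (x - star x)) = Complex.I • (x - star x) := by
      rw [star_smul, star_sub, star_star]
      simp [smul_sub, neg_add_eq_sub]
    exact congrArg Subtype.val this
  have := τ.im_eq_zero _ h
  simp [re] at this ⊢
  linarith

theorem re_star_mul_self_nonneg (x : M.toStarSubalgebra) : 0 ≤ τ.re (star x * x) :=
  τ.re_nonneg (show (0 : H →L[ℂ] H) ≤ star (x : H →L[ℂ] H) * x from star_mul_self_nonneg _)

/-- The inequality of arithmetic and geometric means for the trace inner product. -/
theorem two_mul_re_mul_le (z w : M.toStarSubalgebra) :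
    2 * τ.re (z * w) ≤ τ.re (star z * z) + τ.re (star w * w) := by
  have h := τ.re_star_mul_self_nonneg (star z - w)
  have e : star (star z - w) * (star z - w) =
      z * star z - z * w - (star (z * w) - star w * w) := by
    simp only [star_sub, star_star, star_mul]
    noncomm_ring
  rw [e, re_sub, re_sub, re_sub, re_star, re_mul_comm τ z (star z)] at h
  linarith

theorem re_conjugate_le {x : M.toStarSubalgebra} (hx : ‖x‖ ≤ 1) (y : M.toStarSubalgebra) :
    τ.re (star (x * y) * (x * y)) ≤ τ.re (star y * y) := by
  apply τ.re_mono
  have h1 : star y * (star x * x) * y ≤ star y * 1 * y := by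
    have h2 : star (x : H →L[ℂ] H) * x ≤ 1 := star_mul_self_le_one hx
    exact star_left_conjugate_le_conjugate h2 (y : H →L[ℂ] H)
  rw [mul_one] at h1
  refine le_of_eq_of_le ?_ h1
  rw [star_mul]
  noncomm_ring

/-- Hölder's inequality between the operator norm and the trace norm: `Re τ(xa) ≤ ‖x‖ τ(|a|)`,
where `Q` plays the role of `|a|`. -/
theorem re_mul_le {x a Q : M.toStarSubalgebra} (hx : ‖x‖ ≤ 1) (hQ : 0 ≤ Q)
    (ha : star a * a = Q * Q) : τ.re (x * a) ≤ τ.re Q := by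
  refine le_of_forall_pos_le_add fun ε hε => ?_
  have hs := isSelfAdjoint_of_nonneg hQ
  have hpos : ∀ y : ℝ, 0 < |y| + ε := fun y => by positivity
  have hd : Continuous fun y : ℝ => Real.sqrt (|y| + ε) := by fun_prop
  have hg : Continuous fun y : ℝ => (Real.sqrt (|y| + ε))⁻¹ :=
    hd.inv₀ fun y => (Real.sqrt_pos.2 (hpos y)).ne'
  -- `D = (Q + ε)^{1/2}` and `G = D⁻¹`; the `ε` makes `D` invertible. Writing `xa = (xaG) D`, the
  -- mean inequality bounds `2 Re τ(xa)` by `τ(G a*a G) + τ(D²) ≤ τ(Q) + (τ(Q) + ε)`.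
  set D := fc Q fun y => Real.sqrt (|y| + ε) with hD
  set G := fc Q fun y => (Real.sqrt (|y| + ε))⁻¹ with hG
  have h1 : G * D = 1 := by
    rw [hG, hD, fc_mul _ hg hd, ← one_smul ℂ (1 : M.toStarSubalgebra), ← Complex.ofReal_one,
      ← fc_const Q hs]
    exact fc_congr hQ fun y _ => inv_mul_cancel₀ (Real.sqrt_pos.2 (hpos y)).ne'
  have h2 : star D * D ≤ Q + (ε : ℂ) • 1 := by
    rw [hD, star_fc, fc_mul _ hd hd]
    conv_rhs => rw [← fc_id Q hs, ← fc_const (fc Q fun x => x) (by rwa [fc_id Q hs]) ε, fc_id Q hs]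
    refine le_of_le_of_eq (fc_mono hQ (hd.mul hd) (ψ := fun y => y + ε) (by fun_prop)
      fun y hy => ?_) ?_
    · rw [Real.mul_self_sqrt (hpos y).le, abs_of_nonneg hy]
    · rw [← fc_add _ continuous_id' continuous_const, fc_id Q hs]
  have h3 : star (a * G) * (a * G) ≤ Q := by
    have e : star (a * G) * (a * G) = fc Q fun y => (Real.sqrt (|y| + ε))⁻¹ * (y * y) *
        (Real.sqrt (|y| + ε))⁻¹ := by
      rw [← fc_mul _ (by fun_prop) hg, ← fc_mul _ hg (by fun_prop),
        ← fc_mul _ continuous_id' continuous_id', fc_id Q hs, ← ha, star_mul, hG, star_fc]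
      noncomm_ring
    rw [e]
    conv_rhs => rw [← fc_id Q hs]
    refine fc_mono hQ (by fun_prop) continuous_id' fun y hy => ?_
    have hsq := Real.mul_self_sqrt (hpos y).le
    have hp := Real.sqrt_pos.2 (hpos y)
    rw [abs_of_nonneg hy] at hsq hp ⊢
    rw [inv_mul_eq_div, ← div_eq_mul_inv, div_div, hsq, div_le_iff₀ (by positivity)]
    nlinarith
  have h4 := τ.two_mul_re_mul_le (x * (a * G)) D
  have h5 : x * (a * G) * D = x * a := by
    rw [mul_assoc, mul_assoc a, h1, mul_one]
  rw [h5] at h4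
  have h6 := τ.re_conjugate_le hx (a * G)
  have h7 := τ.re_mono h2
  have h8 := τ.re_mono h3
  rw [re_add, re_smul, re_one] at h7
  linarith

/-- Truncation: `T = A + c B` with `|A| = (|T| - c)₊` and `‖B‖ ≤ 1`. -/
theorem _root_.VonNeumannAlgebra.exists_truncation (T : M.toStarSubalgebra) {c : ℝ} (hc : 0 ≤ c) :
    ∃ A B : M.toStarSubalgebra, T = A + (c : ℂ) • B ∧ ‖B‖ ≤ 1 ∧
      star A * A = fc (absolute T) (fun x => max (x - c) 0) *
        fc (absolute T) (fun x => max (x - c) 0) := by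
  have hm : Continuous fun x : ℝ => max (x - c) 0 := by fun_prop
  have hP := absolute_nonneg T
  have key : ∀ φ : ℝ → ℝ, Continuous φ → star (T * fc (absolute T) φ) * (T * fc (absolute T) φ) =
      fc (absolute T) fun x => (x * φ x) * (x * φ x) := by
    intro φ hφ
    have : star (T * fc (absolute T) φ) * (T * fc (absolute T) φ) =
        fc (absolute T) φ * (star T * T) * fc (absolute T) φ := by
      rw [star_mul, star_fc]; noncomm_ring
    rw [this, star_mul_self_eq_fc, fc_mul _ hφ (by fun_prop), fc_mul _ (by fun_prop) hφ]
    exact fc_congr hP fun x _ => by ring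
  -- For `c = 0` the function `1 / max(x, c)` used below is singular at `0`.
  rcases hc.eq_or_lt with rfl | hc
  · refine ⟨T, 0, by simp, by simp, ?_⟩
    rw [star_mul_self_eq_fc, fc_mul _ hm hm]
    exact fc_congr hP fun x hx => by simp [hx]
  have hr : Continuous fun x : ℝ => (max x c)⁻¹ :=
    (by fun_prop : Continuous fun x : ℝ => max x c).inv₀ fun x => (lt_max_of_lt_right hc).ne'
  -- `|B|` is `|T| / max(|T|, c)`, at most `1`, and `x (1 - c / max(x, c)) = (x - c)₊` for `x ≥ 0`.
  refine ⟨T * fc (absolute T) (fun x => 1 + (-c) * (max x c)⁻¹),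
    T * fc (absolute T) (fun x => (max x c)⁻¹), ?_, ?_, ?_⟩
  · rw [← fc_add _ continuous_const (by fun_prop), fc_const_mul _ _ hr,
      fc_const _ (isSelfAdjoint_absolute T)]
    simp [mul_add]
  · apply norm_le_one_of_norm_star_mul_self_le_one
    rw [key _ hr]
    refine norm_fc_le_one hP fun x hx => ?_
    have h1 : 0 < max x c := lt_max_of_lt_right hc
    have h2 : 0 ≤ x * (max x c)⁻¹ := by positivity
    have h3 : x * (max x c)⁻¹ ≤ 1 := by
      rw [← div_eq_mul_inv, div_le_one h1]; exact le_max_left _ _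
    rw [abs_of_nonneg (by positivity)]
    nlinarith
  · rw [key _ (by fun_prop), fc_mul _ hm hm]
    refine fc_congr hP fun x hx => ?_
    have : x * (1 + -c * (max x c)⁻¹) = max (x - c) 0 := by
      rcases le_total x c with h | h
      · rw [max_eq_right h, max_eq_right (by linarith)]
        field_simp; ring
      · rw [max_eq_left h, max_eq_left (by linarith)]
        have : x ≠ 0 := by linarith
        field_simp; ring
    rw [this]

/-- Duality bound for the trace of `(|T| - c)₊`. -/
theorem re_mul_le_truncation (T : M.toStarSubalgebra) {c : ℝ} (hc : 0 ≤ c)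
    {X Y : M.toStarSubalgebra} (hY : 0 ≤ Y) (hX : ‖X‖ ≤ 1) (hXY : X * star X = Y * Y) :
    τ.re (X * T) ≤ τ.re (fc (absolute T) fun x => max (x - c) 0) + c * τ.re Y := by
  obtain ⟨A, B, hT, hB, hA⟩ := exists_truncation T hc
  have h1 := τ.re_mul_le hX (fc_nonneg (absolute_nonneg T) fun x _ => le_max_right (x - c) 0) hA
  -- Hölder with the roles exchanged: `B` is now the contraction, and `Y` is the absolute value of
  -- `X*`.
  have h2 : τ.re (star B * star X) ≤ τ.re Y :=
    τ.re_mul_le (by rwa [norm_star_eq]) hY (by rwa [star_star])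
  rw [← star_mul, re_star] at h2
  conv_lhs => rw [hT]
  rw [mul_add, re_add, mul_smul_comm, re_smul]
  have := mul_le_mul_of_nonneg_left h2 hc
  linarith

end FaithfulNormalTrace

/-! ### Conditional expectation and the truncated trace -/

section Expectation

variable {H : Type*} [NormedAddCommGroup H] [InnerProductSpace ℂ H] [CompleteSpace H]
  {M N : VonNeumannAlgebra H}

/-- `E` is the adjoint of the inclusion for the trace pairing: the bimodule property moves `X`
inside `E`, and `τ ∘ E = τ` removes `E`. -/
theorem IsTraceExpectation.re_incl_mul {h : N ≤ M} {τ : M.FaithfulNormalTrace}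
    {E : M.toStarSubalgebra →ₗ[ℂ] N.toStarSubalgebra} (hE : IsTraceExpectation h τ E)
    (X : N.toStarSubalgebra) (T : M.toStarSubalgebra) :
    τ.re (incl h X * incl h (E T)) = τ.re (incl h X * T) := by
  have h1 := hE.bimodule X T 1
  rw [map_one, mul_one, mul_one] at h1
  rw [← map_mul, ← h1, FaithfulNormalTrace.re, hE.trace_preserving]
  rfl

/-- The key estimate: a trace-preserving conditional expectation decreases `τ((|T| - c)₊)`. -/
theorem IsTraceExpectation.re_truncation_le {h : N ≤ M} {τ : M.FaithfulNormalTrace}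
    {E : M.toStarSubalgebra →ₗ[ℂ] N.toStarSubalgebra} (hE : IsTraceExpectation h τ E)
    (T : M.toStarSubalgebra) {c : ℝ} (hc : 0 ≤ c) :
    τ.re (fc (absolute (incl h (E T))) fun x => max (x - c) 0) ≤
      τ.re (fc (absolute T) fun x => max (x - c) 0) := by
  refine le_of_forall_pos_le_add fun δ hδ => ?_
  set S := incl h (E T) with hS
  have hP := absolute_nonneg S
  -- `x g(x)` is a continuous substitute for the indicator of `(c, ∞)`: on `x ≥ 0` it lies in `[0,
  -- 1]`, vanishes for `x ≤ c`, and tends to `1` for `x > c` as `δ → 0`.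
  let g : ℝ → ℝ := fun x => max (x - c) 0 / (x * max (x - c) 0 + δ ^ 2)
  have hden : ∀ x : ℝ, 0 < x * max (x - c) 0 + δ ^ 2 := by
    intro x
    rcases le_total x c with hx | hx
    · rw [max_eq_right (by linarith), mul_zero, zero_add]; positivity
    · have : 0 ≤ x := hc.trans hx
      positivity
  have hg : Continuous g :=
    Continuous.div (by fun_prop) (by fun_prop) fun x => (hden x).ne'
  have hg0 : ∀ x, 0 ≤ x → 0 ≤ x * g x := fun x hx =>
    mul_nonneg hx (div_nonneg (le_max_right _ _) (hden x).le)
  have hg1 : ∀ x, 0 ≤ x → x * g x ≤ 1 := fun x hx => by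
    rw [← mul_div_assoc, div_le_one (hden x)]
    nlinarith
  set X : N.toStarSubalgebra := fc (absolute (E T)) g * star (E T) with hX
  -- The inclusion leaves the underlying operator unchanged, so the calculus in `N` and in `M`
  -- agree.
  have hXS : incl h X = fc (absolute S) g * star S := Subtype.ext rfl
  set Y := fc (absolute S) fun x => x * g x with hY
  have hXX : incl h X * star (incl h X) = Y * Y := by
    have : incl h X * star (incl h X) =
        fc (absolute S) g * (star S * S) * fc (absolute S) g := by
      rw [hXS, star_mul, star_star, star_fc]; noncomm_ring
    rw [this, star_mul_self_eq_fc, fc_mul _ hg (by fun_prop), fc_mul _ (by fun_prop) hg, hY,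
      fc_mul _ (by fun_prop) (by fun_prop)]
    exact fc_congr hP fun x _ => by ring
  have hX1 : ‖incl h X‖ ≤ 1 := by
    rw [← norm_star_eq]
    apply norm_le_one_of_norm_star_mul_self_le_one
    rw [star_star, hXX, hY, fc_mul _ (by fun_prop) (by fun_prop)]
    refine norm_fc_le_one hP fun x hx => ?_
    rw [abs_of_nonneg (mul_nonneg (hg0 x hx) (hg0 x hx))]
    nlinarith [hg0 x hx, hg1 x hx]
  have h1 := τ.re_mul_le_truncation T hc (fc_nonneg hP hg0) hX1 hXX
  rw [← hE.re_incl_mul, ← hS, hXS, mul_assoc, star_mul_self_eq_fc, fc_mul _ hg (by fun_prop)] at h1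
  -- Regularizing costs at most `δ`. With `a = (x - c)₊ ≤ x`, the loss is `aδ² / (xa + δ²) ≤ aδ² /
  -- (a² + δ²) ≤ δ`.
  have h2 : fc (absolute S) (fun x => max (x - c) 0) ≤
      fc (absolute S) (fun x => g x * (x * x) + ((-c) * (x * g x) + δ)) := by
    refine fc_mono hP (by fun_prop) (by fun_prop) fun x hx => ?_
    have ha : 0 ≤ max (x - c) 0 := le_max_right _ _
    have hax : max (x - c) 0 ≤ x := max_le (by linarith) hx
    have hxa : (x - c) * max (x - c) 0 = max (x - c) 0 * max (x - c) 0 := by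
      rcases le_total x c with h | h
      · rw [max_eq_right (by linarith)]; ring
      · rw [max_eq_left (by linarith)]
    have hd := hden x
    have e : g x * (x * x) + ((-c) * (x * g x) + δ) =
        x * (max (x - c) 0 * max (x - c) 0) / (x * max (x - c) 0 + δ ^ 2) + δ := by
      rw [← hxa]; simp only [g]; ring
    rw [e]
    generalize max (x - c) 0 = a at *
    rw [div_add' _ _ _ hd.ne', le_div_iff₀ hd]
    nlinarith [mul_nonneg hδ.le (sq_nonneg (a - δ)),
      mul_nonneg hδ.le (mul_nonneg ha (sub_nonneg.2 hax)), pow_pos hδ 3,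
      mul_nonneg ha (mul_nonneg hδ.le hδ.le)]
  have h3 := τ.re_mono h2
  rw [← fc_add _ (by fun_prop) (by fun_prop), ← fc_add _ (by fun_prop) (by fun_prop),
    fc_const_mul _ _ (by fun_prop), fc_const _ (isSelfAdjoint_absolute S), τ.re_add, τ.re_add,
    τ.re_smul, τ.re_smul, τ.re_one] at h3
  linarith

end Expectation

end VonNeumannAlgebra

/-! ### Quantile functions and the variational formula -/

section Quantile

open ProbabilityTheory Filter Topology

/-- The decreasing rearrangement (upper quantile function) of a measure on `ℝ`. -/
noncomputable def upperQuantile (m : Measure ℝ) (s : ℝ) : ℝ :=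
  sInf {t : ℝ | m.real (Set.Ioi t) ≤ s}

variable (m : Measure ℝ) [IsProbabilityMeasure m]

theorem measureReal_Ioi_eq_one_sub_cdf (x : ℝ) : m.real (Set.Ioi x) = 1 - cdf m x := by
  rw [cdf_eq_real, ← Set.compl_Iic, probReal_compl_eq_one_sub measurableSet_Iic]

theorem bddBelow_setOf_measureReal_Ioi_le {s : ℝ} (hs : s < 1) :
    BddBelow {t : ℝ | m.real (Set.Ioi t) ≤ s} := by
  obtain ⟨b, hb⟩ := ((tendsto_cdf_atBot m).eventually_lt_const (sub_pos.2 hs)).exists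
  refine ⟨b, fun t ht => ?_⟩
  by_contra! h
  have h1 := monotone_cdf m h.le
  have h2 : m.real (Set.Ioi t) ≤ s := ht
  rw [measureReal_Ioi_eq_one_sub_cdf] at h2
  linarith

theorem nonempty_setOf_measureReal_Ioi_le {s : ℝ} (hs : 0 < s) :
    {t : ℝ | m.real (Set.Ioi t) ≤ s}.Nonempty := by
  obtain ⟨b, hb⟩ := ((tendsto_cdf_atTop m).eventually_const_lt
    (show 1 - s < 1 by linarith)).exists
  refine ⟨b, ?_⟩
  show m.real (Set.Ioi b) ≤ s
  rw [measureReal_Ioi_eq_one_sub_cdf]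
  linarith

/-- Right continuity of the distribution function makes the infimum attained, hence a Galois
connection; `0 < s < 1` keeps the set nonempty and bounded below. -/
theorem upperQuantile_le_iff {s : ℝ} (hs : s ∈ Set.Ioo (0 : ℝ) 1) (x : ℝ) :
    upperQuantile m s ≤ x ↔ m.real (Set.Ioi x) ≤ s := by
  refine ⟨fun h => ?_, fun h => csInf_le (bddBelow_setOf_measureReal_Ioi_le m hs.2) h⟩
  have h1 : ∀ y > x, 1 - s ≤ cdf m y := by
    intro y hy
    obtain ⟨t, ht, hty⟩ := exists_lt_of_csInf_lt (nonempty_setOf_measureReal_Ioi_le m hs.1)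
      (h.trans_lt hy)
    have h2 : m.real (Set.Ioi t) ≤ s := ht
    rw [measureReal_Ioi_eq_one_sub_cdf] at h2
    linarith [monotone_cdf m hty.le]
  have h2 : Tendsto (cdf m) (𝓝[>] x) (𝓝 (cdf m x)) :=
    ((cdf m).right_continuous x).mono_left (nhdsWithin_mono _ Set.Ioi_subset_Ici_self)
  have h3 : 1 - s ≤ cdf m x :=
    ge_of_tendsto h2 (eventually_nhdsWithin_of_forall h1)
  rw [measureReal_Ioi_eq_one_sub_cdf]
  linarith

theorem antitoneOn_upperQuantile : AntitoneOn (upperQuantile m) (Set.Ioo 0 1) := by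
  intro s hs s' hs' h
  rw [upperQuantile_le_iff m hs']
  exact ((upperQuantile_le_iff m hs _).1 le_rfl).trans h

theorem aemeasurable_upperQuantile :
    AEMeasurable (upperQuantile m) (volume.restrict (Set.Ioo 0 1)) :=
  aemeasurable_restrict_of_antitoneOn measurableSet_Ioo (antitoneOn_upperQuantile m)

/-- By the Galois connection the preimage of `(-∞, x]` is the set of `s ≥ 1 - F(x)` in `(0, 1)`, of
length `F(x)`. -/
theorem map_upperQuantile :
    (volume.restrict (Set.Ioo (0 : ℝ) 1)).map (upperQuantile m) = m := by
  refine Measure.ext_of_Iic _ _ fun x => ?_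
  rw [Measure.map_apply_of_aemeasurable (aemeasurable_upperQuantile m) measurableSet_Iic,
    Measure.restrict_apply' measurableSet_Ioo, ← ofReal_cdf]
  have e : upperQuantile m ⁻¹' Set.Iic x ∩ Set.Ioo 0 1 = Set.Ici (1 - cdf m x) ∩ Set.Ioo 0 1 := by
    ext s
    refine and_congr_left fun hs => ?_
    rw [Set.mem_preimage, Set.mem_Iic, upperQuantile_le_iff m hs, measureReal_Ioi_eq_one_sub_cdf,
      Set.mem_Ici]
  have hx0 := cdf_nonneg m x
  rw [e]
  refine le_antisymm ?_ ?_
  · refine (measure_mono (t := Set.Icc (1 - cdf m x) 1) fun s hs => ⟨hs.1, hs.2.2.le⟩).trans_eq ?_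
    rw [Real.volume_Icc, sub_sub_cancel]
  · refine le_of_eq_of_le ?_ (measure_mono (s := Set.Ioo (1 - cdf m x) 1)
      fun s hs => ⟨hs.1.le, ?_, hs.2⟩)
    · rw [Real.volume_Ioo, sub_sub_cancel]
    · have := cdf_le_one m x
      linarith [hs.1]

theorem integral_comp_upperQuantile {f : ℝ → ℝ} (hf : Continuous f) :
    ∫ s in Set.Ioo (0 : ℝ) 1, f (upperQuantile m s) = ∫ x, f x ∂m := by
  conv_rhs => rw [← map_upperQuantile m]
  rw [integral_map (aemeasurable_upperQuantile m) hf.aestronglyMeasurable]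

variable {m}

/-- Pointwise `q ≤ c + (q - c)₊`, and the nonnegative last term may be integrated over all of `(0,
1)`. -/
theorem setIntegral_upperQuantile_le (hi : IntegrableOn (upperQuantile m) (Set.Ioo 0 1)) {t : ℝ}
    (ht : t ∈ Set.Icc (0 : ℝ) 1) (c : ℝ) :
    ∫ s in Set.Ioo 0 t, upperQuantile m s ≤ t * c + ∫ x, max (x - c) 0 ∂m := by
  have hsub : Set.Ioo 0 t ⊆ Set.Ioo 0 1 := Set.Ioo_subset_Ioo_right ht.2
  have hmax : IntegrableOn (fun s => max (upperQuantile m s - c) 0) (Set.Ioo 0 1) :=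
    (hi.sub (integrable_const c)).pos_part
  rw [← integral_comp_upperQuantile m (f := fun x => max (x - c) 0) (by fun_prop)]
  have h1 : ∫ s in Set.Ioo 0 t, upperQuantile m s ≤
      ∫ s in Set.Ioo 0 t, (c + max (upperQuantile m s - c) 0) :=
    integral_mono (hi.mono_set hsub) ((integrable_const c).add (hmax.mono_set hsub)) fun s => by
      have := le_max_left (upperQuantile m s - c) 0
      dsimp only; linarith
  rw [integral_add (integrable_const c) (hmax.mono_set hsub)] at h1
  have h2 : ∫ s in Set.Ioo 0 t, max (upperQuantile m s - c) 0 ≤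
      ∫ s in Set.Ioo 0 1, max (upperQuantile m s - c) 0 :=
    setIntegral_mono_set hmax (Eventually.of_forall fun _ => le_max_right _ _)
      hsub.eventuallyLE
  have h3 : ∫ _ in Set.Ioo 0 t, c = t * c := by
    simp [Measure.real, ht.1]
  linarith

/-- Both losses in the upper bound vanish when `q ≥ c` before `t` and `q ≤ c` after it; for `t < 1`,
monotonicity allows `c = q(t)`. -/
theorem exists_setIntegral_upperQuantile_eq (hi : IntegrableOn (upperQuantile m) (Set.Ioo 0 1))
    (h0 : ∀ s ∈ Set.Ioo (0 : ℝ) 1, 0 ≤ upperQuantile m s) {t : ℝ} (ht : t ∈ Set.Ioc (0 : ℝ) 1) :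
    ∃ c, 0 ≤ c ∧ t * c + ∫ x, max (x - c) 0 ∂m = ∫ s in Set.Ioo 0 t, upperQuantile m s := by
  obtain ⟨c, hc, hlow, hhigh⟩ : ∃ c, 0 ≤ c ∧ (∀ s ∈ Set.Ioo 0 t, c ≤ upperQuantile m s) ∧
      ∀ s ∈ Set.Ioo (0 : ℝ) 1, t ≤ s → upperQuantile m s ≤ c := by
    rcases ht.2.eq_or_lt with rfl | h1
    -- At `t = 1` nothing lies beyond `t`, so the lower bound `0` serves.
    · exact ⟨0, le_rfl, h0, fun s hs h => absurd hs.2 h.not_gt⟩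
    · have htm : t ∈ Set.Ioo (0 : ℝ) 1 := ⟨ht.1, h1⟩
      exact ⟨upperQuantile m t, h0 t htm,
        fun s hs => antitoneOn_upperQuantile m ⟨hs.1, hs.2.trans h1⟩ htm hs.2.le,
        fun s hs h => antitoneOn_upperQuantile m htm hs h⟩
  refine ⟨c, hc, ?_⟩
  have hsub : Set.Ioo 0 t ⊆ Set.Ioo 0 1 := Set.Ioo_subset_Ioo_right ht.2
  rw [← integral_comp_upperQuantile m (f := fun x => max (x - c) 0) (by fun_prop)]
  have h1 : ∫ s in Set.Ioo 0 t, max (upperQuantile m s - c) 0 =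
      ∫ s in Set.Ioo 0 1, max (upperQuantile m s - c) 0 := by
    refine (setIntegral_eq_of_subset_of_forall_sdiff_eq_zero measurableSet_Ioo hsub
      fun s hs => max_eq_right ?_).symm
    have : t ≤ s := not_lt.1 fun h => hs.2 ⟨hs.1.1, h⟩
    linarith [hhigh s hs.1 this]
  have h2 : ∫ s in Set.Ioo 0 t, max (upperQuantile m s - c) 0 =
      ∫ s in Set.Ioo 0 t, (upperQuantile m s - c) :=
    setIntegral_congr_fun measurableSet_Ioo fun s hs => max_eq_left (by linarith [hlow s hs])
  have h3 : ∫ _ in Set.Ioo 0 t, c = t * c := by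
    simp [Measure.real, ht.1.le]
  rw [← h1, h2, integral_sub (hi.mono_set hsub) (integrable_const c), h3]
  ring

end Quantile

/-! ### Singular values as quantiles, and the conclusion -/

namespace VonNeumannAlgebra

variable {H : Type*} [NormedAddCommGroup H] [InnerProductSpace ℂ H] [CompleteSpace H]
  {M : VonNeumannAlgebra H}

theorem integral_spectralDistribution_eq_re_fc (τ : M.FaithfulNormalTrace)
    (P : M.toStarSubalgebra) (hP : IsSelfAdjoint (P : H →L[ℂ] H)) {f : ℝ → ℝ}
    (hf : Continuous f) : ∫ x, f x ∂(spectralDistribution τ P hP) = τ.re (fc P f) := by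
  refine (integral_spectralDistribution τ P hP ⟨f, hf⟩).trans ?_
  rw [FaithfulNormalTrace.re]
  congr 2
  exact Subtype.ext (cfc_apply f (P : H →L[ℂ] H) hP hf.continuousOn).symm

/-- The spectrum of `|T|` lies in `[0, ∞)`, so for `t < 0` the interval `(t, ∞)` has mass `1 > s`.
-/
theorem singularValueFunction_nonneg (τ : M.FaithfulNormalTrace) (T : M.toStarSubalgebra)
    {s : ℝ} (hs : s ∈ Set.Ioo (0 : ℝ) 1) : 0 ≤ singularValueFunction τ T s := by
  set m := spectralDistribution τ (absolute T) (isSelfAdjoint_absolute T)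
  refine le_csInf (nonempty_setOf_measureReal_Ioi_le m hs.1) fun t ht => ?_
  by_contra! hneg
  have hsub : (Set.Ioi t)ᶜ ⊆ (spectrum ℝ (absolute T : H →L[ℂ] H))ᶜ := fun x hx hx' =>
    absurd (spectrum_nonneg (absolute_nonneg T) x hx')
      (not_le.2 ((Set.notMem_Ioi.1 hx).trans_lt hneg))
  have h1 : m (Set.Ioi t)ᶜ = 0 :=
    measure_mono_null hsub (spectralDistribution_compl_spectrum τ _ _)
  have h2 : m.real (Set.Ioi t) ≤ s := ht
  rw [measureReal_def, (prob_compl_eq_zero_iff (μ := m) measurableSet_Ioi).1 h1] at h2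
  simp only [ENNReal.toReal_one] at h2
  linarith [hs.2]

theorem integrableOn_singularValueFunction (τ : M.FaithfulNormalTrace) (T : M.toStarSubalgebra) :
    IntegrableOn (singularValueFunction τ T) (Set.Ioo 0 1) :=
  (intervalIntegrable_iff_integrableOn_Ioo_of_le zero_le_one).1
    (intervalIntegrable_singularValueFunction τ T (Set.right_mem_Icc.2 zero_le_one))

end VonNeumannAlgebra
theorem mainTheorem2 {H : Type*} [NormedAddCommGroup H] [InnerProductSpace ℂ H] [CompleteSpace H]
    (M : VonNeumannAlgebra H) (hM : M.IsIIOneFactor) (τ : M.FaithfulNormalTrace)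
    (N : VonNeumannAlgebra H) (hNM : N ≤ M) (hN : N.IsDiffuse)
    (E : M.toStarSubalgebra →ₗ[ℂ] N.toStarSubalgebra)
    (hE : VonNeumannAlgebra.IsTraceExpectation hNM τ E)
    (T : M.toStarSubalgebra) :
    VonNeumannAlgebra.IsSubmajorized τ (VonNeumannAlgebra.incl hNM (E T)) T := by
  intro t ht
  rcases ht.1.eq_or_lt with rfl | h0
  · simp
  rw [intervalIntegral.integral_of_le ht.1, intervalIntegral.integral_of_le ht.1,
    integral_Ioc_eq_integral_Ioo, integral_Ioc_eq_integral_Ioo]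
  -- The `c` optimal for `T` also serves, through the upper bound alone, for `E(T)`.
  obtain ⟨c, hc, hT⟩ := exists_setIntegral_upperQuantile_eq
    (VonNeumannAlgebra.integrableOn_singularValueFunction τ T) (fun s =>
      VonNeumannAlgebra.singularValueFunction_nonneg τ T) ⟨h0, ht.2⟩
  have hS := setIntegral_upperQuantile_le
    (VonNeumannAlgebra.integrableOn_singularValueFunction τ (VonNeumannAlgebra.incl hNM (E T))) ht c
  rw [VonNeumannAlgebra.integral_spectralDistribution_eq_re_fc τ _ _ (by fun_prop)] at hT hS
  have h := hE.re_truncation_le T hc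
  exact hS.trans ((add_le_add_right h (t * c)).trans hT.le)
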